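/- For $x\in\mathbb{C}$ and $n\in\mathbb{Z}_{\ge 0}$ let $(x)_n=x(x+1)\cdots(x+n-1)$, with $(x)_0=1$, and for complex $x,k$ let $(x)_k=\Gamma(x+k)/\Gamma(x)$. Then for every complex number $k$ that is not a negative integer, the following series converges absolutely and $$\sum_{n=0}^{\infty}\left(\frac{-1}{16}\right)^n\frac{\left(\frac12\right)_n\left(\frac12+2k\right)_n\left(\frac13+k\right)_n\left(\frac23+k\right)_n}{\left(\frac12+\frac k2\right)_n\left(1+\frac k2\right)_n(1+k)_n(1)_n}\cdot\frac{(51n+7)(2n+1)+k(114n+36k+37)}{2n+k+1}=\frac{12\sqrt3}{\pi}\cdot\frac{(1)_k^2}{\left(\frac14\right)_k\left(\frac34\right)_k}.$$ Here the reciprocals $1/\left(\frac14\right)_k=\Gamma(\frac14)/\Gamma(\frac14+k)$ and $1/\left(\frac34\right)_k=\Gamma(\frac34)/\Gamma(\frac34+k)$ are read as entire functions of $k$, so that the right-hand side is $0$ when $k+\frac14$ or $k+\frac34$ is a non-positive integer. -/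

import Mathlib

/-- The generalized rising factorial `(x)_k = Γ(x + k) / Γ(x)` with complex `x` and `k`.

`Complex.Gamma` takes the value `0` at the poles of `Γ`. Hence, where `Γ(x + k)` has a pole,
`(x)_k = 0` here and its reciprocal `1 / (x)_k = 0` is the value there of the entire function
`k ↦ Γ(x) / Γ(x + k)`, provided that `Γ` has no pole at `x`. -/
noncomputable def risingFactorial (x k : ℂ) : ℂ :=
  Complex.Gamma (x + k) / Complex.Gamma x

/-- The ordinary rising factorial `(x)_n = x (x + 1) ⋯ (x + n - 1)`, `(x)_0 = 1`,
with complex `x` and natural `n`. -/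
noncomputable def risingFactorialNat (x : ℂ) (n : ℕ) : ℂ :=
  ∏ j ∈ Finset.range n, (x + (j : ℂ))

open Filter Topology Bornology

/-! The proof is a WZ argument in the shift `k ↦ k + 1`. Let S(k) be the sum of the series. After
scaling by `wzRatio`, the summand at `k + 1` minus the summand at `k` telescopes in n with a
hypergeometric boundary term (`sum_range_wz`). That term tends to 0, so S(k) = `wzRatio k` · S(k +
1) (`tsum_wz`).

Iterating pushes the parameter to k + N, where only asymptotics are needed. By dominated convergence
S(k + N)/(k + N) tends to 36 times the binomial series of (1 + 1/2)^(-1/2), which is 12√6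
(`tendsto_tsum_wz_div`). By Euler's limit for Γ, N times the product of the ratios tends to
Γ(1+k)²/(Γ(1/4+k)Γ(3/4+k)) (`tendsto_prod_wzRatio_mul_natCast`). The reflection formula Γ(1/4)Γ(3/4)
= π√2 then gives the stated constant.

The shift works for every admissible complex k, so no analytic continuation is needed. Absolute
convergence is contained in `HasSum`, since unconditional and absolute summability agree in ℂ. -/

theorem risingFactorialNat_zero (x : ℂ) : risingFactorialNat x 0 = 1 := by
  simp [risingFactorialNat]

theorem risingFactorialNat_succ (x : ℂ) (n : ℕ) :
    risingFactorialNat x (n + 1) = risingFactorialNat x n * (x + n) := by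
  simp [risingFactorialNat, Finset.prod_range_succ]

/-! ### Limits of rational functions at infinity -/

section RationalLimits

variable {ι : Type*} {l : Filter ι} {z : ι → ℂ}

theorem tendsto_linear_div_linear (hz : Tendsto z l (cobounded ℂ)) (a b c d : ℂ) (hc : c ≠ 0) :
    Tendsto (fun i => (a * z i + b) / (c * z i + d)) l (𝓝 (a / c)) := by
  have hi : Tendsto (fun i => (z i)⁻¹) l (𝓝 0) := tendsto_inv₀_cobounded.comp hz
  have h : Tendsto (fun i => (a + b * (z i)⁻¹) / (c + d * (z i)⁻¹)) l
      (𝓝 ((a + b * 0) / (c + d * 0))) :=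
    ((hi.const_mul b).const_add a).div ((hi.const_mul d).const_add c) (by simpa using hc)
  simp only [mul_zero, add_zero] at h
  refine h.congr' ?_
  filter_upwards [hz.eventually_ne_cobounded 0] with i hi
  rw [← mul_div_mul_right _ _ hi]
  congr 1 <;> field_simp

theorem tendsto_quadratic_div_quadratic (hz : Tendsto z l (cobounded ℂ)) (A B C a b c d : ℂ)
    (ha : a ≠ 0) (hc : c ≠ 0) :
    Tendsto (fun i => (A * z i ^ 2 + B * z i + C) / ((a * z i + b) * (c * z i + d))) l
      (𝓝 (A / (a * c))) := by
  have hi : Tendsto (fun i => (z i)⁻¹) l (𝓝 0) := tendsto_inv₀_cobounded.comp hz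
  have h : Tendsto (fun i => (A + B * (z i)⁻¹ + C * (z i)⁻¹ ^ 2) /
      ((a + b * (z i)⁻¹) * (c + d * (z i)⁻¹))) l
      (𝓝 ((A + B * 0 + C * 0 ^ 2) / ((a + b * 0) * (c + d * 0)))) :=
    ((((hi.const_mul B).const_add A)).add ((hi.pow 2).const_mul C)).div
      (((hi.const_mul b).const_add a).mul ((hi.const_mul d).const_add c))
      (by simpa using ⟨ha, hc⟩)
  simp only [mul_zero, add_zero, ne_eq, OfNat.ofNat_ne_zero, not_false_eq_true, zero_pow] at h
  refine h.congr' ?_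
  filter_upwards [hz.eventually_ne_cobounded 0] with i hi
  rw [← mul_div_mul_right _ _ (pow_ne_zero 2 hi)]
  congr 1 <;> field_simp

end RationalLimits

theorem tendsto_natCast_complex_cobounded :
    Tendsto (fun n : ℕ => (n : ℂ)) atTop (cobounded ℂ) := by
  rw [← tendsto_norm_atTop_iff_cobounded]
  simpa using tendsto_natCast_atTop_atTop (R := ℝ)

theorem tendsto_add_natCast_div_add_natCast (x y : ℂ) :
    Tendsto (fun n : ℕ => (x + n) / (y + n)) atTop (𝓝 1) := by
  simpa [add_comm] using
    tendsto_linear_div_linear tendsto_natCast_complex_cobounded 1 x 1 y one_ne_zero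

/-- The term of the hypergeometric series `₄F₃` with argument `-1 / 16`. -/
noncomputable def hypTerm (a₁ a₂ a₃ a₄ b₁ b₂ b₃ b₄ : ℂ) (n : ℕ) : ℂ :=
  (-1 / 16 : ℂ) ^ n *
    ((risingFactorialNat a₁ n * risingFactorialNat a₂ n * risingFactorialNat a₃ n *
        risingFactorialNat a₄ n) /
      (risingFactorialNat b₁ n * risingFactorialNat b₂ n * risingFactorialNat b₃ n *
        risingFactorialNat b₄ n))

/-! ### Term ratio and convergence of the hypergeometric series -/

section HypTerm

variable (a₁ a₂ a₃ a₄ b₁ b₂ b₃ b₄ : ℂ)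

theorem hypTerm_zero : hypTerm a₁ a₂ a₃ a₄ b₁ b₂ b₃ b₄ 0 = 1 := by
  simp [hypTerm, risingFactorialNat_zero]

/-- No denominator has to be nonzero: inversion is multiplicative even with `0⁻¹ = 0`. -/
theorem hypTerm_succ (n : ℕ) :
    hypTerm a₁ a₂ a₃ a₄ b₁ b₂ b₃ b₄ (n + 1) = hypTerm a₁ a₂ a₃ a₄ b₁ b₂ b₃ b₄ n *
      ((-1 / 16) * ((a₁ + n) / (b₁ + n)) * ((a₂ + n) / (b₂ + n)) * ((a₃ + n) / (b₃ + n)) *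
        ((a₄ + n) / (b₄ + n))) := by
  simp only [hypTerm, risingFactorialNat_succ, pow_succ, div_eq_mul_inv, mul_inv]
  ring

/-- Ratio test: the term ratio tends to 1/16 in norm, so it is eventually below 1/2. The weight n +
1 leaves room for factors of linear growth. -/
theorem summable_succ_mul_hypTerm :
    Summable (fun n : ℕ => ((n : ℂ) + 1) * hypTerm a₁ a₂ a₃ a₄ b₁ b₂ b₃ b₄ n) := by
  refine summable_of_ratio_norm_eventually_le (r := 1 / 2) (by norm_num) ?_
  have h : Tendsto (fun n : ℕ => ‖(2 + (n : ℂ)) / (1 + n) *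
      ((-1 / 16) * ((a₁ + n) / (b₁ + n)) * ((a₂ + n) / (b₂ + n)) * ((a₃ + n) / (b₃ + n)) *
        ((a₄ + n) / (b₄ + n)))‖) atTop (𝓝 ‖(1 : ℂ) * ((-1 / 16) * 1 * 1 * 1 * 1)‖) :=
    ((tendsto_add_natCast_div_add_natCast 2 1).mul
      (((((tendsto_add_natCast_div_add_natCast a₁ b₁).const_mul _).mul
        (tendsto_add_natCast_div_add_natCast a₂ b₂)).mul
        (tendsto_add_natCast_div_add_natCast a₃ b₃)).mul
        (tendsto_add_natCast_div_add_natCast a₄ b₄))).norm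
  filter_upwards [h.eventually_le_const (u := 1 / 2) (by norm_num)] with n hn
  have hn1 : (1 + (n : ℂ)) ≠ 0 := by rw [add_comm]; exact Nat.cast_add_one_ne_zero n
  refine le_trans (le_of_eq ?_) (mul_le_mul_of_nonneg_right hn (norm_nonneg _))
  rw [← norm_mul, hypTerm_succ]
  congr 1
  push_cast
  generalize (a₁ + (n : ℂ)) / (b₁ + n) = u₁
  field_simp
  ring

theorem summable_hypTerm_mul {q : ℕ → ℂ} {c : ℂ}
    (hq : Tendsto (fun n : ℕ => q n / ((n : ℂ) + 1)) atTop (𝓝 c)) :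
    Summable (fun n : ℕ => hypTerm a₁ a₂ a₃ a₄ b₁ b₂ b₃ b₄ n * q n) := by
  refine summable_of_isBigO_nat (summable_succ_mul_hypTerm a₁ a₂ a₃ a₄ b₁ b₂ b₃ b₄).norm ?_
  have h := ((Asymptotics.isBigO_refl (fun n : ℕ => ((n : ℂ) + 1) *
    hypTerm a₁ a₂ a₃ a₄ b₁ b₂ b₃ b₄ n) atTop).mul (hq.isBigO_one ℂ)).norm_right
  refine h.congr_left (fun n => ?_) |>.congr_right (fun n => by simp)
  have hn1 : ((n : ℂ) + 1) ≠ 0 := Nat.cast_add_one_ne_zero n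
  field_simp

end HypTerm

/-! ### The WZ pair and the recurrence in k -/

section WZPair

/-- The hypergeometric factor of the summand. -/
noncomputable def wzTerm (k : ℂ) (n : ℕ) : ℂ :=
  hypTerm (1 / 2) (1 / 2 + 2 * k) (1 / 3 + k) (2 / 3 + k) (1 / 2 + k / 2) (1 + k / 2) (1 + k) 1 n

/-- The hypergeometric factor with the two middle parameters raised by one. -/
noncomputable def wzTermRaised (k : ℂ) (n : ℕ) : ℂ :=
  hypTerm (1 / 2) (1 / 2 + 2 * k) (4 / 3 + k) (5 / 3 + k) (1 / 2 + k / 2) (1 + k / 2) (1 + k) 1 n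

/-- The rational factor of the summand. -/
noncomputable def wzWeight (k : ℂ) (n : ℕ) : ℂ :=
  ((51 * (n : ℂ) + 7) * (2 * (n : ℂ) + 1) + k * (114 * (n : ℂ) + 36 * k + 37)) /
    (2 * (n : ℂ) + k + 1)

/-- The ratio of the values of the closed form at `k` and at `k + 1`. -/
noncomputable def wzRatio (k : ℂ) : ℂ :=
  (1 / 4 + k) * (3 / 4 + k) / (1 + k) ^ 2

/-- The rational factor of the companion in the WZ pair. -/
noncomputable def wzCertificate (k : ℂ) (n : ℕ) : ℂ :=
  (3 + 7 * k - (13 + 30 * k) * (n + 1) - 6 * ((n : ℂ) + 1) ^ 2) *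
    ((-1 / 4) * (1 / 2 + n) * (1 / 2 + 2 * k + n)) /
      ((1 + k + 2 * n) * (2 + k + 2 * n) * (1 + k + n))

variable {k : ℂ}

theorem one_add_add_natCast_ne_zero (hk : ∀ m : ℕ, k ≠ -((m : ℂ) + 1)) (m : ℕ) :
    1 + k + m ≠ 0 := fun h => hk m (by linear_combination h)

theorem one_add_add_two_mul_natCast_ne_zero (hk : ∀ m : ℕ, k ≠ -((m : ℂ) + 1)) (m : ℕ) :
    1 + k + 2 * m ≠ 0 := by
  exact_mod_cast one_add_add_natCast_ne_zero hk (2 * m)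

theorem two_add_add_two_mul_natCast_ne_zero (hk : ∀ m : ℕ, k ≠ -((m : ℂ) + 1)) (m : ℕ) :
    2 + k + 2 * m ≠ 0 := by
  have h := one_add_add_natCast_ne_zero hk (2 * m + 1)
  push_cast at h
  exact fun h' => h (by linear_combination h')

theorem add_natCast_ne_neg (hk : ∀ m : ℕ, k ≠ -((m : ℂ) + 1)) (N : ℕ) (m : ℕ) :
    k + N ≠ -((m : ℂ) + 1) := fun h => hk (N + m) (by push_cast; linear_combination h)

/-- `wzTermRaised` is the common factor for the terms at `k` and `k + 1`. Raising 1/3 + k and 2/3 +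
k by one avoids dividing by 1/3 + k + n or 2/3 + k + n, which may vanish for admissible k. -/
theorem wzTermRaised_succ (hk : ∀ m : ℕ, k ≠ -((m : ℂ) + 1)) (n : ℕ) :
    wzTermRaised k (n + 1) = wzTermRaised k n *
      ((-1 / 4) * (1 / 2 + n) * (1 / 2 + 2 * k + n) * (4 / 3 + k + n) * (5 / 3 + k + n) /
        ((1 + k + 2 * n) * (2 + k + 2 * n) * (1 + k + n) * (1 + n))) := by
  rw [wzTermRaised, hypTerm_succ, wzTermRaised]
  congr 1
  have h1 := one_add_add_natCast_ne_zero hk n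
  have h2 := one_add_add_two_mul_natCast_ne_zero hk n
  have h3 := two_add_add_two_mul_natCast_ne_zero hk n
  have h4 : 1 + (n : ℂ) ≠ 0 := by rw [add_comm]; exact Nat.cast_add_one_ne_zero n
  rw [show 1 / 2 + k / 2 + (n : ℂ) = (1 + k + 2 * n) / 2 by ring,
    show 1 + k / 2 + (n : ℂ) = (2 + k + 2 * n) / 2 by ring]
  field_simp
  ring

theorem wzTerm_succ (hk : ∀ m : ℕ, k ≠ -((m : ℂ) + 1)) (n : ℕ) :
    wzTerm k (n + 1) = wzTermRaised k n *
      ((1 / 3 + k) * (2 / 3 + k) * ((-1 / 4) * (1 / 2 + n) * (1 / 2 + 2 * k + n)) /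
        ((1 + k + 2 * n) * (2 + k + 2 * n) * (1 + k + n) * (1 + n))) := by
  -- This is (x)_n (x + n) = x (x + 1)_n for x = 1/3 + k and x = 2/3 + k, kept in product form so
  -- that it survives zeros of x + n.
  have key : ∀ n : ℕ, wzTerm k n * ((1 / 3 + k + n) * (2 / 3 + k + n)) =
      wzTermRaised k n * ((1 / 3 + k) * (2 / 3 + k)) := by
    intro n
    induction n with
    | zero => simp [wzTerm, wzTermRaised, hypTerm_zero]
    | succ n ih =>
      rw [wzTerm, wzTermRaised, hypTerm_succ, hypTerm_succ]
      rw [wzTerm, wzTermRaised] at ih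
      push_cast
      simp only [div_eq_mul_inv] at ih ⊢
      linear_combination ((-1 / 16) * ((1 / 2 + n) * (1 / 2 + k / 2 + n)⁻¹) *
        ((1 / 2 + 2 * k + n) * (1 + k / 2 + n)⁻¹) *
        ((4 / 3 + k + n) * (1 + k + n)⁻¹) * ((5 / 3 + k + n) * (1 + (n : ℂ))⁻¹)) * ih
  have h1 := one_add_add_natCast_ne_zero hk n
  have h2 := one_add_add_two_mul_natCast_ne_zero hk n
  have h3 := two_add_add_two_mul_natCast_ne_zero hk n
  have h4 : 1 + (n : ℂ) ≠ 0 := by rw [add_comm]; exact Nat.cast_add_one_ne_zero n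
  have h := key n
  rw [wzTerm, hypTerm_succ, ← wzTerm]
  rw [show 1 / 2 + k / 2 + (n : ℂ) = (1 + k + 2 * n) / 2 by ring,
    show 1 + k / 2 + (n : ℂ) = (2 + k + 2 * n) / 2 by ring]
  trans (wzTerm k n * ((1 / 3 + k + n) * (2 / 3 + k + n))) *
    (((-1 / 4) * (1 / 2 + n) * (1 / 2 + 2 * k + n)) /
      ((1 + k + 2 * n) * (2 + k + 2 * n) * (1 + k + n) * (1 + n)))
  · field_simp
    ring
  · rw [h]
    ring

/-- Raising 1/2 + 2k by two would divide by (1/2 + 2k)(3/2 + 2k) = 4(1/4 + k)(3/4 + k); the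
numerator of `wzRatio` cancels this, so its zeros cause no exception. -/
theorem wzRatio_mul_wzTerm (hk : ∀ m : ℕ, k ≠ -((m : ℂ) + 1)) (n : ℕ) :
    wzRatio k * wzTerm (k + 1) n = wzTermRaised k n *
      ((1 / 2 + 2 * k + n) * (3 / 2 + 2 * k + n) / (4 * (1 + k + 2 * n) * (1 + k + n))) := by
  induction n with
  | zero =>
    have h1 := one_add_add_natCast_ne_zero hk 0
    simp only [Nat.cast_zero, add_zero] at h1
    simp only [wzTerm, wzTermRaised, hypTerm_zero, wzRatio, Nat.cast_zero, mul_zero, add_zero]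
    field_simp
    ring
  | succ n ih =>
    have h1 := one_add_add_natCast_ne_zero hk n
    have h1' : 2 + k + n ≠ 0 := fun h =>
      one_add_add_natCast_ne_zero hk (n + 1) (by push_cast; linear_combination h)
    have h2 := one_add_add_two_mul_natCast_ne_zero hk n
    have h3 := two_add_add_two_mul_natCast_ne_zero hk n
    have h2' : 3 + k + 2 * n ≠ 0 := fun h =>
      one_add_add_two_mul_natCast_ne_zero hk (n + 1) (by push_cast; linear_combination h)
    have h4 : 1 + (n : ℂ) ≠ 0 := by rw [add_comm]; exact Nat.cast_add_one_ne_zero n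
    rw [wzTerm, hypTerm_succ, ← wzTerm, ← mul_assoc, ih, wzTermRaised_succ hk]
    push_cast
    rw [show 1 / 2 + (k + 1) / 2 + (n : ℂ) = (2 + k + 2 * n) / 2 by ring,
      show 1 + (k + 1) / 2 + (n : ℂ) = (3 + k + 2 * n) / 2 by ring,
      show 1 + (k + 1) + (n : ℂ) = 2 + k + n by ring,
      show 1 + k + 2 * ((n : ℂ) + 1) = 3 + k + 2 * n by ring,
      show 1 + k + ((n : ℂ) + 1) = 2 + k + n by ring]
    field_simp
    ring

/-- The WZ identity in summed form. Once everything is written over `wzTermRaised k n`, each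
induction step is an identity of rational functions in k and n. -/
theorem sum_range_wz (hk : ∀ m : ℕ, k ≠ -((m : ℂ) + 1)) (n : ℕ) :
    ∑ i ∈ Finset.range (n + 1), (wzRatio k * (wzTerm (k + 1) i * wzWeight (k + 1) i) -
      wzTerm k i * wzWeight k i) = wzTermRaised k n * wzCertificate k n := by
  induction n with
  | zero =>
    have h1 := one_add_add_natCast_ne_zero hk 0
    have h3 := two_add_add_two_mul_natCast_ne_zero hk 0
    simp only [Nat.cast_zero, mul_zero, add_zero] at h1 h3
    rw [zero_add, Finset.sum_range_one, ← mul_assoc, wzRatio_mul_wzTerm hk]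
    simp only [wzTerm, wzTermRaised, hypTerm_zero, wzWeight, wzCertificate, Nat.cast_zero, mul_zero,
      add_zero, zero_add, one_mul]
    rw [show k + 1 + 1 = 2 + k by ring, show k + 1 = 1 + k by ring]
    field_simp
    ring
  | succ n ih =>
    rw [Finset.sum_range_succ, ih, ← mul_assoc, wzRatio_mul_wzTerm hk, wzTerm_succ hk,
      wzTermRaised_succ hk]
    have h1 := one_add_add_natCast_ne_zero hk n
    have h1' : 2 + k + n ≠ 0 := fun h =>
      one_add_add_natCast_ne_zero hk (n + 1) (by push_cast; linear_combination h)
    have h2 := one_add_add_two_mul_natCast_ne_zero hk n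
    have h3 := two_add_add_two_mul_natCast_ne_zero hk n
    have h2' : 3 + k + 2 * n ≠ 0 := fun h =>
      one_add_add_two_mul_natCast_ne_zero hk (n + 1) (by push_cast; linear_combination h)
    have h3' : 4 + k + 2 * n ≠ 0 := fun h =>
      two_add_add_two_mul_natCast_ne_zero hk (n + 1) (by push_cast; linear_combination h)
    have h4 : 1 + (n : ℂ) ≠ 0 := by rw [add_comm]; exact Nat.cast_add_one_ne_zero n
    simp only [wzWeight, wzCertificate]
    push_cast
    rw [show 1 + k + 2 * ((n : ℂ) + 1) = 3 + k + 2 * n by ring,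
      show 2 + k + 2 * ((n : ℂ) + 1) = 4 + k + 2 * n by ring,
      show 1 + k + ((n : ℂ) + 1) = 2 + k + n by ring,
      show 2 * ((n : ℂ) + 1) + k + 1 = 3 + k + 2 * n by ring,
      show 2 * ((n : ℂ) + 1) + (k + 1) + 1 = 4 + k + 2 * n by ring]
    rw [mul_comm 2 (n : ℂ)] at h2 h3 h2' h3'
    field_simp
    ring

theorem summable_wzTerm_mul_wzWeight (k : ℂ) :
    Summable (fun n : ℕ => wzTerm k n * wzWeight k n) := by
  -- The leading coefficients in n are 51 · 2 = 102 above and 2 · 1 below.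
  refine summable_hypTerm_mul _ _ _ _ _ _ _ _ (c := 102 / (2 * 1)) ?_
  refine (tendsto_quadratic_div_quadratic tendsto_natCast_complex_cobounded 102 (65 + 114 * k)
    (7 + 36 * k ^ 2 + 37 * k) 2 (k + 1) 1 1 two_ne_zero one_ne_zero).congr fun n => ?_
  rw [wzWeight, div_div]
  congr 1 <;> ring

theorem tendsto_wzTermRaised_mul_wzCertificate (k : ℂ) :
    Tendsto (fun n : ℕ => wzTermRaised k n * wzCertificate k n) atTop (𝓝 0) := by
  refine Summable.tendsto_atTop_zero (summable_hypTerm_mul _ _ _ _ _ _ _ _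
    (c := (-6) / (1 * 1) * ((-1 / 4) / 2) * (1 / 2)) ?_)
  refine (((tendsto_quadratic_div_quadratic tendsto_natCast_complex_cobounded (-6) (-25 - 30 * k)
    (-16 - 23 * k) 1 1 1 (1 + k) one_ne_zero one_ne_zero).mul
    (tendsto_linear_div_linear tendsto_natCast_complex_cobounded (-1 / 4) (-1 / 8) 2 (1 + k)
      two_ne_zero)).mul
    (tendsto_linear_div_linear tendsto_natCast_complex_cobounded 1 (1 / 2 + 2 * k) 2 (2 + k)
      two_ne_zero)).congr fun n => ?_
  rw [wzCertificate, div_div, div_mul_div_comm, div_mul_div_comm]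
  congr 1 <;> ring

theorem tsum_wz (hk : ∀ m : ℕ, k ≠ -((m : ℂ) + 1)) :
    ∑' n, wzTerm k n * wzWeight k n =
      wzRatio k * ∑' n, wzTerm (k + 1) n * wzWeight (k + 1) n := by
  have h := ((summable_wzTerm_mul_wzWeight (k + 1)).hasSum.mul_left (wzRatio k)).sub
    (summable_wzTerm_mul_wzWeight k).hasSum
  have h0 := tendsto_nhds_unique ((tendsto_add_atTop_iff_nat 1).2 h.tendsto_sum_nat)
    ((tendsto_wzTermRaised_mul_wzCertificate k).congr fun n => (sum_range_wz hk n).symm)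
  exact (sub_eq_zero.1 h0).symm

theorem tsum_wz_iterate (hk : ∀ m : ℕ, k ≠ -((m : ℂ) + 1)) (N : ℕ) :
    ∑' n, wzTerm k n * wzWeight k n = (∏ j ∈ Finset.range N, wzRatio (k + j)) *
      ∑' n, wzTerm (k + N) n * wzWeight (k + N) n := by
  induction N with
  | zero => simp
  | succ N ih =>
    rw [ih, tsum_wz (add_natCast_ne_neg hk N), Finset.prod_range_succ, mul_assoc]
    push_cast
    rw [add_assoc]

end WZPair

/-! ### Asymptotics of the sum for large k -/

section LargeParameter

/-- The factors are paired so that, for Re k ≥ 0, each quotient involving k is bounded in norm by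
its limit as k → ∞: 4, 1 and 2. With 1/16 these give 1/2, both the modulus in `binomialTerm` and the
dominating ratio in `norm_wzTerm_le`. -/
theorem wzTerm_succ_eq_mul (k : ℂ) (n : ℕ) :
    wzTerm k (n + 1) = wzTerm k n * ((-1 / 16) * ((1 / 2 + n) / (1 + n)) *
      ((2 * k + (1 / 2 + n)) / (1 / 2 * k + (1 / 2 + n))) *
      ((1 * k + (1 / 3 + n)) / (1 * k + (1 + n))) *
      ((1 * k + (2 / 3 + n)) / (1 / 2 * k + (1 + n)))) := by
  rw [wzTerm, hypTerm_succ, ← wzTerm]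
  simp only [div_eq_mul_inv, show 1 * k + (1 + (n : ℂ)) = 1 + k + n by ring]
  ring

/-- The limit of `wzTerm k n` as `k → ∞`. -/
noncomputable def binomialTerm (n : ℕ) : ℂ :=
  risingFactorialNat (1 / 2) n / risingFactorialNat 1 n * (-1 / 2) ^ n

theorem tendsto_wzTerm {ι : Type*} {l : Filter ι} {z : ι → ℂ}
    (hz : Tendsto z l (cobounded ℂ)) (n : ℕ) :
    Tendsto (fun i => wzTerm (z i) n) l (𝓝 (binomialTerm n)) := by
  induction n with
  | zero =>
    simpa [wzTerm, hypTerm_zero, binomialTerm, risingFactorialNat_zero] using tendsto_const_nhds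
  | succ n ih =>
    have h := ih.mul ((((tendsto_linear_div_linear hz 2 (1 / 2 + n) (1 / 2) (1 / 2 + n)
      (by norm_num)).const_mul ((-1 / 16) * ((1 / 2 + (n : ℂ)) / (1 + n)))).mul
      (tendsto_linear_div_linear hz 1 (1 / 3 + n) 1 (1 + n) one_ne_zero)).mul
      (tendsto_linear_div_linear hz 1 (2 / 3 + n) (1 / 2) (1 + n) (by norm_num)))
    have e : binomialTerm (n + 1) = binomialTerm n *
        ((-1 / 16) * ((1 / 2 + n) / (1 + n)) * (2 / (1 / 2)) * (1 / 1) * (1 / (1 / 2))) := by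
      simp only [binomialTerm, risingFactorialNat_succ, pow_succ, div_eq_mul_inv, mul_inv]
      norm_num
      ring
    rw [e]
    exact h.congr fun i => (wzTerm_succ_eq_mul _ _).symm

theorem norm_div_le_of_re_im {x y : ℂ} {c : ℝ} (hc : 0 ≤ c) (hre : |x.re| ≤ c * |y.re|)
    (him : |x.im| ≤ c * |y.im|) : ‖x / y‖ ≤ c := by
  rw [norm_div]
  refine div_le_of_le_mul₀ (norm_nonneg _) hc ?_
  rw [← abs_of_nonneg (norm_nonneg x), ← abs_of_nonneg (mul_nonneg hc (norm_nonneg y)), ← sq_le_sq,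
    mul_pow, ← Complex.normSq_eq_norm_sq, ← Complex.normSq_eq_norm_sq, Complex.normSq_apply,
    Complex.normSq_apply]
  have h1 := mul_self_le_mul_self (abs_nonneg _) hre
  have h2 := mul_self_le_mul_self (abs_nonneg _) him
  rw [abs_mul_abs_self] at h1 h2
  rw [mul_mul_mul_comm, abs_mul_abs_self] at h1 h2
  linarith

theorem norm_wzTerm_le {k : ℂ} (hk : 0 ≤ k.re) (n : ℕ) : ‖wzTerm k n‖ ≤ (1 / 2) ^ n := by
  induction n with
  | zero => simp [wzTerm, hypTerm_zero]
  | succ n ih =>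
    have hn : (0 : ℝ) ≤ n := Nat.cast_nonneg n
    have him : ∀ a b c d : ℂ, a.im = 0 → b.im = 0 → ∀ u v w : ℝ, 0 ≤ v → |u| ≤ w * v →
        c = u * k + (a + n) → d = v * k + (b + n) → |c.im| ≤ w * |d.im| := by
      rintro a b c d ha hb u v w hv huv rfl rfl
      simp only [Complex.add_im, Complex.mul_im, Complex.ofReal_re, Complex.ofReal_im, zero_mul,
        add_zero, ha, hb, Complex.natCast_im, abs_mul, abs_of_nonneg hv, ← mul_assoc]
      exact mul_le_mul_of_nonneg_right huv (abs_nonneg _)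
    have h0 : ‖(1 / 2 + (n : ℂ)) / (1 + n)‖ ≤ 1 := by
      refine norm_div_le_of_re_im zero_le_one ?_ (by simp)
      simp
      rw [abs_of_nonneg (by positivity), abs_of_nonneg (by positivity)]
      linarith
    have h1 : ‖(2 * k + (1 / 2 + n)) / (1 / 2 * k + (1 / 2 + n))‖ ≤ 4 := by
      refine norm_div_le_of_re_im (by norm_num) ?_ (him (1 / 2) (1 / 2) _ _ (by simp) (by simp)
        2 (1 / 2) 4 (by norm_num) (by norm_num) (by push_cast; ring) (by push_cast; ring))
      simp
      rw [abs_of_nonneg (by positivity), abs_of_nonneg (by positivity)]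
      linarith
    have h2 : ‖(1 * k + (1 / 3 + n)) / (1 * k + (1 + n))‖ ≤ 1 := by
      refine norm_div_le_of_re_im (by norm_num) ?_ (him (1 / 3) 1 _ _ (by simp) (by simp)
        1 1 1 (by norm_num) (by norm_num) (by push_cast; ring) (by push_cast; ring))
      simp
      rw [abs_of_nonneg (by positivity), abs_of_nonneg (by positivity)]
      linarith
    have h3 : ‖(1 * k + (2 / 3 + n)) / (1 / 2 * k + (1 + n))‖ ≤ 2 := by
      refine norm_div_le_of_re_im (by norm_num) ?_ (him (2 / 3) 1 _ _ (by simp) (by simp)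
        1 (1 / 2) 2 (by norm_num) (by norm_num) (by push_cast; ring) (by push_cast; ring))
      simp
      rw [abs_of_nonneg (by positivity), abs_of_nonneg (by positivity)]
      linarith
    rw [wzTerm_succ_eq_mul, norm_mul, pow_succ]
    refine mul_le_mul ih ?_ (norm_nonneg _) (by positivity)
    rw [norm_mul, norm_mul, norm_mul, norm_mul]
    calc _ ≤ 1 / 16 * 1 * 4 * 1 * (2 : ℝ) := by
          gcongr
          norm_num
      _ = 1 / 2 := by norm_num

/-- The denominator has norm at least ‖k‖, and the numerator is at most ‖k‖² times a quadratic in n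
because ‖k‖ ≥ 1. The constant 200 is generous. -/
theorem norm_wzWeight_div_le {k : ℂ} (hk : 1 ≤ k.re) (n : ℕ) :
    ‖wzWeight k n / k‖ ≤ 200 * ((n : ℝ) ^ 2 + n + 1) := by
  have hn : (0 : ℝ) ≤ n := Nat.cast_nonneg n
  have hk1 : 1 ≤ ‖k‖ := hk.trans (Complex.re_le_norm k)
  have hd : ‖k‖ ≤ ‖2 * (n : ℂ) + k + 1‖ := by
    have hpos : 0 < ‖2 * (n : ℂ) + k + 1‖ := by
      refine lt_of_lt_of_le ?_ (Complex.re_le_norm _)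
      simp
      linarith
    have := norm_div_le_of_re_im (x := k) (y := 2 * (n : ℂ) + k + 1) zero_le_one
      (by
        simp
        rw [abs_of_nonneg (by linarith), abs_of_nonneg (by linarith)]
        linarith) (by simp)
    rwa [norm_div, div_le_one hpos] at this
  rw [wzWeight, div_div, norm_div, norm_mul]
  refine div_le_of_le_mul₀ (by positivity) (by positivity) ?_
  have hnum : ‖(51 * (n : ℂ) + 7) * (2 * (n : ℂ) + 1) + k * (114 * (n : ℂ) + 36 * k + 37)‖ ≤
      (51 * n + 7) * (2 * n + 1) + ‖k‖ * (114 * n + 36 * ‖k‖ + 37) := by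
    refine (norm_add_le _ _).trans (add_le_add ?_ ?_)
    · rw [norm_mul]
      refine mul_le_mul ?_ ?_ (norm_nonneg _) (by positivity) <;>
      · refine (norm_add_le _ _).trans ?_
        simp
    · rw [norm_mul]
      refine mul_le_mul_of_nonneg_left ?_ (norm_nonneg _)
      refine (norm_add₃_le ..).trans ?_
      simp
  have h2 : 200 * ((n : ℝ) ^ 2 + n + 1) * (‖k‖ * ‖k‖) ≤
      200 * ((n : ℝ) ^ 2 + n + 1) * (‖2 * (n : ℂ) + k + 1‖ * ‖k‖) := by gcongr
  refine (hnum.trans ?_).trans h2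
  have h3 : ‖k‖ ≤ ‖k‖ * ‖k‖ := le_mul_of_one_le_left (norm_nonneg _) hk1
  have h4 : 1 ≤ ‖k‖ * ‖k‖ := hk1.trans h3
  nlinarith [mul_le_mul_of_nonneg_left h3 hn, mul_le_mul_of_nonneg_left h4 hn,
    mul_le_mul_of_nonneg_left h4 (mul_nonneg hn hn)]

theorem risingFactorialNat_eq_eval_ascPochhammer (x : ℂ) (n : ℕ) :
    risingFactorialNat x n = (ascPochhammer ℂ n).eval x := by
  induction n with
  | zero => simp [risingFactorialNat_zero]
  | succ n ih => rw [risingFactorialNat_succ, ih, ascPochhammer_succ_eval]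

/-- Binomial series of (1 - y)^(-1/2) at y = -1/2, with value √(2/3). -/
theorem hasSum_binomialTerm : HasSum binomialTerm ((Real.sqrt 6 / 3 : ℝ) : ℂ) := by
  have h := (Complex.one_div_one_sub_cpow_hasFPowerSeriesOnBall_zero (1 / 2)).hasSum
    (y := -1 / 2) (by simp [enorm_eq_nnnorm])
  have hval : 1 / ((1 : ℂ) - (0 + -1 / 2)) ^ (1 / 2 : ℂ) = ((Real.sqrt 6 / 3 : ℝ) : ℂ) := by
    have e : (1 : ℂ) - (0 + -1 / 2) = ((3 / 2 : ℝ) : ℂ) := by push_cast; ring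
    have e' : (1 / 2 : ℂ) = ((1 / 2 : ℝ) : ℂ) := by push_cast; ring
    rw [e, e', ← Complex.ofReal_cpow (by norm_num), ← Real.sqrt_eq_rpow, ← Complex.ofReal_one,
      ← Complex.ofReal_div]
    congr 1
    symm
    have h3 : Real.sqrt 6 = 2 * Real.sqrt (3 / 2) := by
      rw [show (6 : ℝ) = 2 ^ 2 * (3 / 2) by norm_num, Real.sqrt_mul (by norm_num),
        Real.sqrt_sq (by norm_num)]
    have h4 : Real.sqrt (3 / 2) ^ 2 = 3 / 2 := Real.sq_sqrt (by norm_num)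
    have h5 : Real.sqrt (3 / 2) ≠ 0 := by positivity
    rw [h3, eq_div_iff h5]
    linear_combination (2 / 3) * h4
  rw [hval] at h
  refine Eq.subst (motive := fun f => HasSum f _) (funext fun n => ?_) h
  have hc : Ring.choose (1 / 2 + (n : ℂ) - 1) n = risingFactorialNat (1 / 2) n / n.factorial := by
    rw [Ring.choose, show 1 / 2 + (n : ℂ) - 1 - n + 1 = 1 / 2 by ring,
      eq_div_iff (by exact_mod_cast n.factorial_ne_zero), mul_comm, ← nsmul_eq_mul,
      Ring.factorial_nsmul_multichoose_eq_ascPochhammer,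
      Polynomial.ascPochhammer_smeval_eq_eval, risingFactorialNat_eq_eval_ascPochhammer]
  have h1 : risingFactorialNat 1 n = n.factorial := by
    rw [risingFactorialNat_eq_eval_ascPochhammer, ascPochhammer_eval_one]
  simp only [FormalMultilinearSeries.ofScalars_apply_eq, hc, h1, binomialTerm, smul_eq_mul]

theorem tendsto_tsum_wz_div (k : ℂ) :
    Tendsto (fun N : ℕ => (∑' n, wzTerm (k + N) n * wzWeight (k + N) n) / (k + N)) atTop
      (𝓝 ((12 * Real.sqrt 6 : ℝ) : ℂ)) := by
  have hz : Tendsto (fun N : ℕ => k + N) atTop (cobounded ℂ) :=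
    (tendsto_const_add_cobounded k).comp tendsto_natCast_complex_cobounded
  have hre : ∀ᶠ N : ℕ in atTop, 1 ≤ (k + N).re := by
    have : Tendsto (fun N : ℕ => k.re + (N : ℝ)) atTop atTop :=
      tendsto_atTop_add_const_left _ _ tendsto_natCast_atTop_atTop
    simpa using this.eventually_ge_atTop 1
  -- For fixed n, `wzWeight k n` behaves like 36k as k → ∞.
  have hsum : (∑' n, binomialTerm n * 36) = ((12 * Real.sqrt 6 : ℝ) : ℂ) := by
    rw [tsum_mul_right, hasSum_binomialTerm.tsum_eq]
    push_cast
    ring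
  rw [← hsum]
  simp_rw [← tsum_div_const]
  refine tendsto_tsum_of_dominated_convergence
    (bound := fun n : ℕ => (1 / 2 : ℝ) ^ n * (200 * ((n : ℝ) ^ 2 + n + 1))) ?_ ?_ ?_
  · have h2 := summable_pow_mul_geometric_of_norm_lt_one 2 (r := (1 / 2 : ℝ)) (by norm_num)
    have h1 := summable_pow_mul_geometric_of_norm_lt_one 1 (r := (1 / 2 : ℝ)) (by norm_num)
    have h0 := summable_pow_mul_geometric_of_norm_lt_one 0 (r := (1 / 2 : ℝ)) (by norm_num)
    refine (((h2.add h1).add h0).mul_left 200).congr fun n => ?_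
    ring
  · intro n
    have hw : Tendsto (fun N : ℕ => wzWeight (k + N) n / (k + N)) atTop (𝓝 (36 / (1 * 1))) := by
      refine (tendsto_quadratic_div_quadratic hz 36 (114 * n + 37) ((51 * n + 7) * (2 * n + 1))
        1 (2 * n + 1) 1 0 one_ne_zero one_ne_zero).congr fun N => ?_
      rw [wzWeight, div_div]
      congr 1 <;> ring
    have := (tendsto_wzTerm hz n).mul hw
    rw [mul_one, div_one] at this
    exact this.congr fun N => (mul_div_assoc _ _ _).symm
  · filter_upwards [hre] with N hN n
    rw [mul_div_assoc, norm_mul]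
    exact mul_le_mul (norm_wzTerm_le (zero_le_one.trans hN) n) (norm_wzWeight_div_le hN n)
      (norm_nonneg _) (by positivity)

end LargeParameter

/-! ### Gamma function limits and the closed form -/

section ClosedForm

/-- At a pole s = -m the product below in `GammaSeq` contains a zero factor once n ≥ m, so both
sides are 0 by convention. This covers the k at which the closed form vanishes. -/
theorem tendsto_inv_GammaSeq (s : ℂ) :
    Tendsto (fun n : ℕ => (Complex.GammaSeq s n)⁻¹) atTop (𝓝 (Complex.Gamma s)⁻¹) := by
  by_cases hs : Complex.Gamma s = 0
  · obtain ⟨m, rfl⟩ := (Complex.Gamma_eq_zero_iff s).1 hs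
    rw [hs, inv_zero]
    refine tendsto_const_nhds.congr' ?_
    filter_upwards [eventually_ge_atTop m] with n hn
    rw [Complex.GammaSeq, Finset.prod_eq_zero (Finset.mem_range.2 (Nat.lt_succ_of_le hn))
      (neg_add_cancel _), div_zero, inv_zero]
  · exact (Complex.GammaSeq_tendsto_Gamma s).inv₀ hs

/-- `GammaSeq` at N has N + 1 factors below, hence the range. The extra N balances the powers: (1/4
+ k) + (3/4 + k) + 1 = 2(1 + k). -/
theorem prod_wzRatio_mul_natCast (k : ℂ) {N : ℕ} (hN : N ≠ 0) :
    (∏ j ∈ Finset.range (N + 1), wzRatio (k + j)) * N =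
      (Complex.GammaSeq (1 / 4 + k) N)⁻¹ * (Complex.GammaSeq (3 / 4 + k) N)⁻¹ *
        Complex.GammaSeq (1 + k) N ^ 2 := by
  have hN' : (N : ℂ) ≠ 0 := Nat.cast_ne_zero.2 hN
  have hf : (N.factorial : ℂ) ≠ 0 := Nat.cast_ne_zero.2 N.factorial_ne_zero
  have hp : (N : ℂ) ^ (1 / 4 + k) * (N : ℂ) ^ (3 / 4 + k) * N = ((N : ℂ) ^ (1 + k)) ^ 2 := by
    nth_rw 3 [← Complex.cpow_one (N : ℂ)]
    rw [← Complex.cpow_add _ _ hN', ← Complex.cpow_add _ _ hN', sq, ← Complex.cpow_add _ _ hN']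
    congr 1
    ring
  have h1 : (N : ℂ) ^ (1 / 4 + k) ≠ 0 := by simp [Complex.cpow_eq_zero_iff, hN]
  have h3 : (N : ℂ) ^ (3 / 4 + k) ≠ 0 := by simp [Complex.cpow_eq_zero_iff, hN]
  simp only [wzRatio, Finset.prod_div_distrib, Finset.prod_mul_distrib, Finset.prod_pow,
    Complex.GammaSeq, ← add_assoc]
  rw [inv_div, inv_div, div_pow, mul_pow, ← hp]
  generalize (N : ℂ) ^ (1 / 4 + k) = x at *
  generalize (N : ℂ) ^ (3 / 4 + k) = y at *
  generalize ∏ j ∈ Finset.range (N + 1), (1 / 4 + k + (j : ℂ)) = u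
  generalize ∏ j ∈ Finset.range (N + 1), (3 / 4 + k + (j : ℂ)) = v
  field_simp

theorem tendsto_prod_wzRatio_mul_natCast (k : ℂ) :
    Tendsto (fun N : ℕ => (∏ j ∈ Finset.range (N + 1), wzRatio (k + j)) * N) atTop
      (𝓝 ((Complex.Gamma (1 / 4 + k))⁻¹ * (Complex.Gamma (3 / 4 + k))⁻¹ *
        Complex.Gamma (1 + k) ^ 2)) := by
  refine (((tendsto_inv_GammaSeq _).mul (tendsto_inv_GammaSeq _)).mul
    ((Complex.GammaSeq_tendsto_Gamma _).pow 2)).congr' ?_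
  filter_upwards [eventually_ne_atTop 0] with N hN
  exact (prod_wzRatio_mul_natCast k hN).symm

theorem tsum_wz_eq {k : ℂ} (hk : ∀ m : ℕ, k ≠ -((m : ℂ) + 1)) :
    ∑' n, wzTerm k n * wzWeight k n =
      (Complex.Gamma (1 / 4 + k))⁻¹ * (Complex.Gamma (3 / 4 + k))⁻¹ * Complex.Gamma (1 + k) ^ 2 *
        ((12 * Real.sqrt 6 : ℝ) : ℂ) := by
  -- Correction factor (k + N + 1)/N: the product is normalised by N, the sum after N + 1 shifts by
  -- k + N + 1.
  have h1 : Tendsto (fun N : ℕ => (1 * (N : ℂ) + (k + 1)) / (1 * N + 0)) atTop (𝓝 (1 / 1)) :=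
    tendsto_linear_div_linear tendsto_natCast_complex_cobounded 1 (k + 1) 1 0 one_ne_zero
  have h := ((tendsto_prod_wzRatio_mul_natCast k).mul
    ((tendsto_tsum_wz_div k).comp (tendsto_add_atTop_nat 1))).mul h1
  rw [div_one, mul_one] at h
  refine tendsto_nhds_unique (tendsto_const_nhds.congr' ?_) h
  filter_upwards [eventually_ne_atTop 0] with N hN
  have hN' : (N : ℂ) ≠ 0 := Nat.cast_ne_zero.2 hN
  have hkN : k + ((N : ℂ) + 1) ≠ 0 := fun h => hk N (by linear_combination h)
  rw [tsum_wz_iterate hk (N + 1), Function.comp_apply]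
  push_cast
  rw [show 1 * (N : ℂ) + (k + 1) = k + (N + 1) by ring]
  rw [add_zero, one_mul]
  field_simp

theorem Gamma_one_fourth_mul_Gamma_three_fourths :
    Complex.Gamma (1 / 4) * Complex.Gamma (3 / 4) = ((Real.pi * Real.sqrt 2 : ℝ) : ℂ) := by
  have h := Complex.Gamma_mul_Gamma_one_sub (1 / 4)
  rw [show (1 : ℂ) - 1 / 4 = 3 / 4 by norm_num,
    show (Real.pi : ℂ) * (1 / 4) = ((Real.pi / 4 : ℝ) : ℂ) by push_cast; ring,
    ← Complex.ofReal_sin, Real.sin_pi_div_four, ← Complex.ofReal_div] at h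
  rw [h]
  congr 1
  have h2 : Real.sqrt 2 ^ 2 = 2 := Real.sq_sqrt (by norm_num)
  have h2' : Real.sqrt 2 ≠ 0 := by positivity
  field_simp
  exact h2.symm

end ClosedForm

theorem mainTheorem3 (k : ℂ) (hk : ∀ m : ℕ, k ≠ -((m : ℂ) + 1)) :
    HasSum
      (fun n : ℕ =>
        (-1 / 16 : ℂ) ^ n *
          ((risingFactorialNat (1 / 2) n * risingFactorialNat (1 / 2 + 2 * k) n *
              risingFactorialNat (1 / 3 + k) n * risingFactorialNat (2 / 3 + k) n) /
            (risingFactorialNat (1 / 2 + k / 2) n * risingFactorialNat (1 + k / 2) n *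
              risingFactorialNat (1 + k) n * risingFactorialNat 1 n)) *
          (((51 * (n : ℂ) + 7) * (2 * (n : ℂ) + 1) + k * (114 * (n : ℂ) + 36 * k + 37)) /
            (2 * (n : ℂ) + k + 1)))
      (((12 * Real.sqrt 3 / Real.pi : ℝ) : ℂ) *
        (risingFactorial 1 k ^ 2 /
          (risingFactorial (1 / 4) k * risingFactorial (3 / 4) k))) := by
  have h6 : Real.sqrt 6 = Real.sqrt 3 * Real.sqrt 2 := by
    rw [← Real.sqrt_mul (by norm_num)]
    norm_num
  have hpi : (Real.pi : ℂ) ≠ 0 := Complex.ofReal_ne_zero.2 Real.pi_ne_zero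
  have hval : (Complex.Gamma (1 / 4 + k))⁻¹ * (Complex.Gamma (3 / 4 + k))⁻¹ *
      Complex.Gamma (1 + k) ^ 2 * ((12 * Real.sqrt 6 : ℝ) : ℂ) =
      ((12 * Real.sqrt 3 / Real.pi : ℝ) : ℂ) *
        (risingFactorial 1 k ^ 2 / (risingFactorial (1 / 4) k * risingFactorial (3 / 4) k)) := by
    trans ((12 * Real.sqrt 3 / Real.pi : ℝ) : ℂ) * (Complex.Gamma (1 + k) ^ 2 *
      (Complex.Gamma (1 / 4) * Complex.Gamma (3 / 4)) *
        ((Complex.Gamma (1 / 4 + k))⁻¹ * (Complex.Gamma (3 / 4 + k))⁻¹))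
    · rw [Gamma_one_fourth_mul_Gamma_three_fourths, h6]
      push_cast
      field_simp
    · simp only [risingFactorial, Complex.Gamma_one, div_eq_mul_inv, mul_inv, inv_inv]
      ring
  rw [← hval, ← tsum_wz_eq hk]
  exact (summable_wzTerm_mul_wzWeight k).hasSum
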